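/- Let $(M^{2n},\langle\,,\rangle,J)$ be a connected Kaehler manifold of real dimension $2n$, that is, a connected smooth Riemannian manifold with a smooth orthogonal almost complex structure $J$ that is parallel with respect to the Levi-Civita connection. Let $f\colon M^{2n}\to\mathbb{R}^{2n+p}$ be a smooth isometric immersion with normal bundle $N_fM$ and second fundamental form $\alpha\colon TM\times TM\to N_fM$. Assume that at every $x\in M^{2n}$ the first normal space $$N_1(x)=\operatorname{span}\{\alpha(X,Y)\colon X,Y\in T_xM\}$$ is all of $N_fM(x)$, and that there is a smooth vector bundle isometry $\mathcal{J}$ of $N_fM$ (over the identity of $M^{2n}$) such that $$\mathcal{J}\alpha(X,Y)=\alpha(X,JY)\quad\text{for all } X,Y\in T_xM \text{ and all } x\in M^{2n}.$$ Then $p$ is even, $p=2q$, and $f$ is holomorphic: there is a linear isometry $\varphi\colon\mathbb{R}^{2n+2q}\to\mathbb{C}^{n+q}$ (of real inner product spaces) such that $\varphi\circ f\colon M^{2n}\to\mathbb{C}^{n+q}$ is holomorphic, i.e. $(\varphi\circ f)_*JX=i\,(\varphi\circ f)_*X$ for every tangent vector $X$. -/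

import Mathlib

open Bundle Manifold
open scoped ContDiff

noncomputable section

namespace RealKaehler

section Kaehler

variable {E : Type*} [NormedAddCommGroup E] [NormedSpace ℝ E] [FiniteDimensional ℝ E]
  {H : Type*} [TopologicalSpace H] (I : ModelWithCorners ℝ E H)
  {M : Type*} [TopologicalSpace M] [ChartedSpace H M] [IsManifold I ∞ M]
  [RiemannianBundle (fun x : M => TangentSpace I x)]
  [IsContMDiffRiemannianBundle I ∞ E (fun x : M => TangentSpace I x)]

/-- `∇` is the Levi-Civita connection of the Riemannian manifold `M`: it is torsion free and
compatible with the metric, `v ⟨Y, Z⟩ = ⟨∇_v Y, Z⟩ + ⟨Y, ∇_v Z⟩` for all vector fields `Y`, `Z`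
differentiable at `x` and all `v ∈ T_x M`. -/
structure IsLeviCivita (cov : CovariantDerivative I E (fun x : M => TangentSpace I x)) : Prop where
  torsion_eq_zero : cov.torsion = 0
  metric : ∀ (Y Z : ∀ x : M, TangentSpace I x) (x : M),
    MDifferentiableAt I (I.prod 𝓘(ℝ, E))
      (fun y => TotalSpace.mk' E (E := fun x : M => TangentSpace I x) y (Y y)) x →
    MDifferentiableAt I (I.prod 𝓘(ℝ, E))
      (fun y => TotalSpace.mk' E (E := fun x : M => TangentSpace I x) y (Z y)) x →
    ∀ v : TangentSpace I x,
      mvfderiv I (fun y => inner ℝ (Y y) (Z y)) x v =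
        inner ℝ (cov Y x v) (Z x) + inner ℝ (Y x) (cov Z x v)

/-- `J` is a Kaehler structure on the Riemannian manifold `M`: a smooth field of endomorphisms of
the tangent bundle with `J² = -1`, orthogonal with respect to the metric, and parallel with respect
to the Levi-Civita connection, `∇_X (J Y) = J (∇_X Y)`. -/
structure IsKaehlerStructure (J : ∀ x : M, TangentSpace I x →L[ℝ] TangentSpace I x) : Prop where
  smooth : ContMDiff I (I.prod 𝓘(ℝ, E →L[ℝ] E)) ∞
    (fun x => TotalSpace.mk' (E →L[ℝ] E)
      (E := fun x : M => TangentSpace I x →L[ℝ] TangentSpace I x) x (J x))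
  sq : ∀ (x : M) (v : TangentSpace I x), J x (J x v) = -v
  orthogonal : ∀ (x : M) (v w : TangentSpace I x), inner ℝ (J x v) (J x w) = inner ℝ v w
  parallel : ∃ cov : CovariantDerivative I E (fun x : M => TangentSpace I x),
    IsLeviCivita I cov ∧
      ∀ (Y : ∀ x : M, TangentSpace I x) (x : M),
        MDifferentiableAt I (I.prod 𝓘(ℝ, E))
          (fun y => TotalSpace.mk' E (E := fun x : M => TangentSpace I x) y (Y y)) x →
        ∀ v : TangentSpace I x, cov (fun y => J y (Y y)) x v = J x (cov Y x v)

end Kaehler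

section Immersion

variable {E : Type*} [NormedAddCommGroup E] [NormedSpace ℝ E]
  {H : Type*} [TopologicalSpace H] (I : ModelWithCorners ℝ E H)
  {M : Type*} [TopologicalSpace M] [ChartedSpace H M] [IsManifold I ∞ M]
  {W : Type*} [NormedAddCommGroup W] [InnerProductSpace ℝ W]

/-- `f` is a (smooth) isometric immersion of the Riemannian manifold `M` into the Euclidean
space `W`. -/
structure IsIsometricImmersion [RiemannianBundle (fun x : M => TangentSpace I x)]
    (f : M → W) : Prop where
  smooth : ContMDiff I 𝓘(ℝ, W) ∞ f
  isometric : ∀ (x : M) (v w : TangentSpace I x),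
    inner ℝ (mvfderiv I f x v) (mvfderiv I f x w) = inner ℝ v w

/-- The normal space `N_f M(x)`, the orthogonal complement of `f_* T_x M` in `W`. -/
def normalSpace (f : M → W) (x : M) : Submodule ℝ W :=
  ((mvfderiv I f x).toLinearMap.range)ᗮ

variable [FiniteDimensional ℝ W]

/-- The second fundamental form `α(v, w) = (D_v (f_* Y))^⊥` of `f` at `x`, where `D` is the
derivative in `W` and `Y` is a vector field with `Y(x) = w`, smooth near `x`; here `Y` is the one
that is constant in the trivialization of the tangent bundle given by the preferred chart
at `x`. -/
def secondFundamentalForm (f : M → W) (x : M) (v w : TangentSpace I x) : normalSpace I f x :=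
  (normalSpace I f x).orthogonalProjectionOnto
    (mvfderiv I (fun y => mvfderiv I f y (FiberBundle.extend E w y)) x v)

/-- The first normal space `N_1(x)`, the span of the image of the second fundamental form, as a
subspace of the normal space. -/
def firstNormalSpace (f : M → W) (x : M) : Submodule ℝ (normalSpace I f x) :=
  Submodule.span ℝ {η | ∃ v w : TangentSpace I x, η = secondFundamentalForm I f x v w}

/-- A fibrewise linear isometry `𝒥` of the normal bundle is smooth, i.e. a section of
`Aut(N_f M)`: it maps smooth normal vector fields to smooth normal vector fields. -/
def IsSmoothNormalIsometry (f : M → W)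
    (𝒥 : ∀ x : M, normalSpace I f x ≃ₗᵢ[ℝ] normalSpace I f x) : Prop :=
  ∀ η : ∀ x : M, normalSpace I f x,
    ContMDiff I 𝓘(ℝ, W) ∞ (fun x => (η x : W)) →
      ContMDiff I 𝓘(ℝ, W) ∞ (fun x => (𝒥 x (η x) : W))

end Immersion

section Holomorphic

variable {E : Type*} [NormedAddCommGroup E] [NormedSpace ℝ E]
  {H : Type*} [TopologicalSpace H] (I : ModelWithCorners ℝ E H)
  {M : Type*} [TopologicalSpace M] [ChartedSpace H M]
  {Z : Type*} [NormedAddCommGroup Z] [NormedSpace ℝ Z] [NormedSpace ℂ Z]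

/-- `F : M → Z` is holomorphic from `(M, J)` into the complex vector space `Z`: it is smooth and
`F_* ∘ J = i F_*`. -/
def IsHolomorphicMap (J : ∀ x : M, TangentSpace I x →L[ℝ] TangentSpace I x) (F : M → Z) : Prop :=
  ContMDiff I 𝓘(ℝ, Z) ∞ F ∧
    ∀ (x : M) (v : TangentSpace I x), mvfderiv I F x (J x v) = Complex.I • mvfderiv I F x v

end Holomorphic

end RealKaehler

end

noncomputable section

namespace RealKaehler

section Algebra

/-- A trilinear expression symmetric in its first two and skew in its last two arguments
vanishes. -/
theorem eq_zero_of_symm_of_skew {α : Type*} {T : α → α → α → ℝ}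
    (hs : ∀ a b c, T a b c = T b a c) (ha : ∀ a b c, T a b c = -T a c b) (a b c : α) :
    T a b c = 0 := by
  linarith [ha a b c, hs a c b, ha c a b, hs c b a, ha b c a, hs b a c]

/-- An expression in five arguments, symmetric in the first three and skew under the exchange
of the second pair of arguments with the third one, vanishes. -/
theorem eq_zero_of_symm_of_skew_pairs {α : Type*} {T : α → α → α → α → α → ℝ}
    (h₁ : ∀ x a b c d, T x a b c d = T a x b c d) (h₂ : ∀ x a b c d, T x a b c d = T x b a c d)
    (h₃ : ∀ x a b c d, T x a b c d = -T x c d a b) (x a b c d : α) :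
    T x a b c d = 0 := by
  have h₄ : ∀ x a b c d, T x a b c d = T x a b d c := fun x a b c d => by
    rw [h₃ x a b c d, h₂ x c d, ← h₃]
  have key : ∀ x a b c d, T x a b c d = T x c b a d := fun x a b c d => by
    have e₁ : T x a b c d = -T c x d a b := by rw [h₃, h₁]
    have e₂ : -T c x d a b = T a c b x d := by rw [← h₃, h₁]
    have e₃ : T a c b x d = -T a x d c b := by rw [h₃, h₄]
    have e₄ : -T a x d c b = -T x a d c b := by rw [h₁]
    have e₅ : -T x a d c b = T x c b a d := by rw [← h₃]
    rw [e₁, e₂, e₃, e₄, e₅]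
  have e : T x a b c d = T x c d a b := by
    rw [key x a b c d, h₂ x c b, h₄ x b c, key x b c d a, h₂ x d c, h₄ x c d b a]
  linarith [h₃ x a b c d]

/-- An orthogonal complex structure on a Euclidean space is linearly isometric to multiplication
by `i` on some `ℂᵐ`. -/
theorem exists_linearIsometryEquiv_complex {W : Type*} [NormedAddCommGroup W]
    [InnerProductSpace ℝ W] [FiniteDimensional ℝ W] (P : W →L[ℝ] W)
    (hsq : ∀ w, P (P w) = -w) (hP : ∀ u w, inner ℝ (P u) (P w) = inner ℝ u w) :
    ∃ m : ℕ, Module.finrank ℝ W = 2 * m ∧ ∃ φ : W ≃ₗᵢ[ℝ] EuclideanSpace ℂ (Fin m),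
      ∀ w, φ (P w) = Complex.I • φ w := by
  have hskew : ∀ u w, inner ℝ (P u) w = -inner ℝ u (P w) := fun u w => by
    rw [← hP u (P w), hsq, inner_neg_right, neg_neg]
  have hself : ∀ u, inner ℝ (P u) u = 0 := fun u => by
    have := hskew u u
    rw [real_inner_comm (P u) u] at this
    linarith
  let : Module ℂ W :=
    { smul := fun z w => z.re • w + z.im • P w
      one_smul := fun w => by
        change (1 : ℂ).re • w + (1 : ℂ).im • P w = w
        simp
      mul_smul := fun z z' w => by
        change (z * z').re • w + (z * z').im • P w =
          z.re • (z'.re • w + z'.im • P w) + z.im • P (z'.re • w + z'.im • P w)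
        simp only [Complex.mul_re, Complex.mul_im, map_add, map_smul, hsq]
        module
      smul_zero := fun z => by
        change z.re • (0 : W) + z.im • P 0 = 0
        simp
      smul_add := fun z w w' => by
        change z.re • (w + w') + z.im • P (w + w') =
          (z.re • w + z.im • P w) + (z.re • w' + z.im • P w')
        simp only [map_add]
        module
      add_smul := fun z z' w => by
        change (z + z').re • w + (z + z').im • P w =
          (z.re • w + z.im • P w) + (z'.re • w + z'.im • P w)
        simp only [Complex.add_re, Complex.add_im]
        module
      zero_smul := fun w => by
        change (0 : ℂ).re • w + (0 : ℂ).im • P w = 0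
        simp }
  have smul_def : ∀ (z : ℂ) (w : W), z • w = z.re • w + z.im • P w := fun _ _ => rfl
  let : NormedSpace ℂ W :=
    { norm_smul_le := fun z w => by
        refine le_of_eq ?_
        rw [← sq_eq_sq₀ (norm_nonneg _) (by positivity), mul_pow, Complex.sq_norm,
          ← real_inner_self_eq_norm_sq, ← real_inner_self_eq_norm_sq, smul_def,
          Complex.normSq_apply]
        simp only [inner_add_left, inner_add_right, inner_smul_left, inner_smul_right, hP,
          hself, real_inner_comm (P w) w, RCLike.conj_to_real]
        ring }
  let : InnerProductSpace ℂ W :=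
    { inner := fun u w => ⟨inner ℝ u w, inner ℝ (P u) w⟩
      norm_sq_eq_re_inner := fun w => (real_inner_self_eq_norm_sq w).symm
      conj_inner_symm := fun u w => by
        apply Complex.ext
        · exact real_inner_comm _ _
        · change -inner ℝ (P w) u = inner ℝ (P u) w
          rw [hskew u w, real_inner_comm]
      add_left := fun u v w => by
        apply Complex.ext
        · exact inner_add_left _ _ _
        · change inner ℝ (P (u + v)) w = inner ℝ (P u) w + inner ℝ (P v) w
          rw [map_add, inner_add_left]
      smul_left := fun u w z => by
        apply Complex.ext
        · change inner ℝ (z.re • u + z.im • P u) w =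
            z.re * inner ℝ u w - (-z.im) * inner ℝ (P u) w
          simp only [inner_add_left, inner_smul_left, RCLike.conj_to_real]
          ring
        · change inner ℝ (P (z.re • u + z.im • P u)) w =
            z.re * inner ℝ (P u) w + (-z.im) * inner ℝ u w
          simp only [map_add, map_smul, hsq, inner_add_left, inner_smul_left, inner_neg_left,
            RCLike.conj_to_real]
          ring }
  have : FiniteDimensional ℂ W := by
    obtain ⟨s, hs⟩ := (inferInstance : Module.Finite ℝ W)
    refine ⟨s, eq_top_iff.2 fun w _ => ?_⟩
    have hw : w ∈ Submodule.span ℝ (s : Set W) := hs ▸ Submodule.mem_top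
    induction hw using Submodule.span_induction with
    | mem x h => exact Submodule.subset_span h
    | zero => exact Submodule.zero_mem _
    | add x y _ _ hx hy => exact Submodule.add_mem _ (hx trivial) (hy trivial)
    | smul a x _ hx =>
      have : a • x = (a : ℂ) • x := by rw [smul_def]; simp
      rw [this]
      exact Submodule.smul_mem _ _ (hx trivial)
  let e : W ≃ₗᵢ[ℂ] EuclideanSpace ℂ (Fin (Module.finrank ℂ W)) := (stdOrthonormalBasis ℂ W).repr
  let φ : W ≃ₗᵢ[ℝ] EuclideanSpace ℂ (Fin (Module.finrank ℂ W)) :=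
    { toFun := e
      invFun := e.symm
      left_inv := e.left_inv
      right_inv := e.right_inv
      map_add' := e.map_add
      map_smul' := fun a w => by
        have : a • w = (a : ℂ) • w := by rw [smul_def]; simp
        rw [this, map_smul]
        exact Complex.coe_smul a (e w)
      norm_map' := e.norm_map }
  refine ⟨Module.finrank ℂ W, ?_, φ, fun w => ?_⟩
  · rw [φ.toLinearEquiv.finrank_eq, finrank_real_of_complex, finrank_euclideanSpace_fin]
  · have : P w = Complex.I • w := by rw [smul_def]; simp
    rw [this]
    exact e.map_smul _ _

end Algebra

section Calculus

variable {E W : Type*} [NormedAddCommGroup E] [NormedSpace ℝ E]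
  [NormedAddCommGroup W] [InnerProductSpace ℝ W] [FiniteDimensional ℝ W]

open Topology

/-- A field of endomorphisms of `W` mapping finitely many smooth functions that span `W` at `y`
to smooth functions is smooth at `y`. -/
theorem contDiffAt_of_spanning {P : E → W →L[ℝ] W} {U : Set E} {y : E} (hU : U ∈ 𝓝 y)
    {S : Set ((E → W) × (E → W))}
    (hS : ∀ s ∈ S, ContDiffAt ℝ ∞ s.1 y ∧ ContDiffAt ℝ ∞ s.2 y ∧ ∀ z ∈ U, P z (s.1 z) = s.2 z)
    (hspan : Submodule.span ℝ ((fun s : (E → W) × (E → W) => s.1 y) '' S) = ⊤) :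
    ContDiffAt ℝ ∞ P y := by
  let b := Module.Basis.ofSpan hspan.ge
  have hb : ∀ i, ∃ s ∈ S, s.1 y = b i := fun i =>
    Module.Basis.ofSpan_subset hspan.ge (Set.mem_range_self i)
  choose s hsS hsb using hb
  have := Module.Finite.finite_basis b
  have := Fintype.ofFinite ((linearIndepOn_empty ℝ (id : W → W)).extend (Set.empty_subset
    ((fun s : (E → W) × (E → W) => s.1 y) '' S)))
  let A : E → W →L[ℝ] W := fun z => ∑ i, (b.coord i).toContinuousLinearMap.smulRight ((s i).1 z)
  let C : E → W →L[ℝ] W := fun z => ∑ i, (b.coord i).toContinuousLinearMap.smulRight ((s i).2 z)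
  have hA : ContDiffAt ℝ ∞ A y := ContDiffAt.sum fun i _ =>
    contDiffAt_const.smulRight (hS _ (hsS i)).1
  have hC : ContDiffAt ℝ ∞ C y := ContDiffAt.sum fun i _ =>
    contDiffAt_const.smulRight (hS _ (hsS i)).2.1
  have hAy : A y = 1 := by
    ext w
    simp [A, hsb, b.sum_repr]
  have hPA : ∀ z ∈ U, P z * A z = C z := fun z hz => by
    ext w
    simp [A, C, (hS _ (hsS _)).2.2 z hz]
  have hunit : ∀ᶠ z in 𝓝 y, IsUnit (A z) :=
    hA.continuousAt.eventually_mem (Units.isOpen.mem_nhds (by simp [hAy]))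
  have hinv : ContDiffAt ℝ ∞ (fun z => C z * Ring.inverse (A z)) y := by
    have h : ContDiffAt ℝ ∞ Ring.inverse (A y) := by
      rw [hAy]
      exact contDiffAt_ringInverse ℝ (1 : (W →L[ℝ] W)ˣ)
    exact hC.mul (h.comp y hA)
  refine hinv.congr_of_eventuallyEq ?_
  filter_upwards [hU, hunit] with z hz hzu
  rw [← hPA z hz, mul_assoc, Ring.mul_inverse_cancel _ hzu, mul_one]

set_option synthInstance.maxHeartbeats 100000 in
/-- A field `P` of skew endomorphisms that maps the first and second derivatives of `g` to those of
a map with differential `k` has zero derivative, if the first two derivatives of `g` span. -/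
theorem hasFDerivAt_zero_of_second_order {U : Set E} (hU : IsOpen U) {g : E → W}
    {k : E → E →L[ℝ] W} (hg : ContDiffOn ℝ ∞ g U) (hk : ContDiffOn ℝ ∞ k U)
    {P : E → W →L[ℝ] W} (hskew : ∀ y ∈ U, ∀ u w, inner ℝ (P y u) w = -inner ℝ u (P y w))
    (hP₁ : ∀ y ∈ U, ∀ w, P y (fderiv ℝ g y w) = k y w)
    (hP₂ : ∀ y ∈ U, ∀ v w, P y (fderiv ℝ (fderiv ℝ g) y v w) = fderiv ℝ k y v w)
    (hspan : ∀ y ∈ U, ∀ u : W, (∀ w, inner ℝ (fderiv ℝ g y w) u = 0) →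
      (∀ v w, inner ℝ (fderiv ℝ (fderiv ℝ g) y v w) u = 0) → u = 0) {y : E} (hy : y ∈ U) :
    HasFDerivAt P (0 : E →L[ℝ] W →L[ℝ] W) y := by
  have hUn : ∀ {y}, y ∈ U → U ∈ 𝓝 y := fun h => hU.mem_nhds h
  have hgc : ∀ {y}, y ∈ U → ContDiffAt ℝ ∞ g y := fun h => hg.contDiffAt (hUn h)
  have hg₁ : ∀ {y}, y ∈ U → ContDiffAt ℝ ∞ (fderiv ℝ g) y := fun h =>
    (hgc h).fderiv_right (by simp)
  have hg₂ : ∀ {y}, y ∈ U → ContDiffAt ℝ ∞ (fderiv ℝ (fderiv ℝ g)) y := fun h =>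
    (hg₁ h).fderiv_right (by simp)
  have hkc : ∀ {y}, y ∈ U → ContDiffAt ℝ ∞ k y := fun h => hk.contDiffAt (hUn h)
  have hk₁ : ∀ {y}, y ∈ U → ContDiffAt ℝ ∞ (fderiv ℝ k) y := fun h =>
    (hkc h).fderiv_right (by simp)
  have hPc : ∀ {y}, y ∈ U → ContDiffAt ℝ ∞ P y := by
    intro y hy
    refine contDiffAt_of_spanning (hUn hy)
      (S := Set.range (fun w => (fun z => fderiv ℝ g z w, fun z => k z w)) ∪
        Set.range (fun p : E × E => (fun z => fderiv ℝ (fderiv ℝ g) z p.1 p.2,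
          fun z => fderiv ℝ k z p.1 p.2))) ?_ ?_
    · rintro _ (⟨w, rfl⟩ | ⟨⟨v, w⟩, rfl⟩)
      · exact ⟨(hg₁ hy).clm_apply contDiffAt_const, (hkc hy).clm_apply contDiffAt_const,
          fun z hz => hP₁ z hz w⟩
      · exact ⟨((hg₂ hy).clm_apply contDiffAt_const).clm_apply contDiffAt_const,
          ((hk₁ hy).clm_apply contDiffAt_const).clm_apply contDiffAt_const,
          fun z hz => hP₂ z hz v w⟩
    · rw [← Submodule.orthogonal_eq_bot_iff, Submodule.eq_bot_iff]
      intro u hu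
      refine hspan y hy u (fun w => hu _ (Submodule.subset_span ?_))
        (fun v w => hu _ (Submodule.subset_span ?_))
      · exact ⟨_, Or.inl ⟨w, rfl⟩, rfl⟩
      · exact ⟨_, Or.inr ⟨(v, w), rfl⟩, rfl⟩
  have hPd : ∀ {y}, y ∈ U → HasFDerivAt P (fderiv ℝ P y) y := fun h =>
    ((hPc h).differentiableAt (by simp)).hasFDerivAt
  have hP₁d : ∀ {y}, y ∈ U → HasFDerivAt (fderiv ℝ P) (fderiv ℝ (fderiv ℝ P) y) y := fun h =>
    (((hPc h).fderiv_right (m := ∞) (by simp)).differentiableAt (by simp)).hasFDerivAt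
  have hgd : ∀ {y}, y ∈ U → HasFDerivAt (fderiv ℝ g) (fderiv ℝ (fderiv ℝ g) y) y := fun h =>
    ((hg₁ h).differentiableAt (by simp)).hasFDerivAt
  have hQ₁ : ∀ y ∈ U, ∀ v w, fderiv ℝ P y v (fderiv ℝ g y w) = 0 := by
    intro y hy v w
    have h₁ := (hPd hy).clm_apply ((hgd hy).clm_apply (hasFDerivAt_const w y))
    have h₂ := ((hkc hy).differentiableAt (by simp)).hasFDerivAt.clm_apply
      (hasFDerivAt_const w y)
    have h₃ := h₁.unique (h₂.congr_of_eventuallyEq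
      (Filter.eventually_of_mem (hUn hy) fun z hz => hP₁ z hz w))
    have h₄ := DFunLike.congr_fun h₃ v
    simpa [hP₂ y hy] using h₄
  have hQ₂ : ∀ u v w, fderiv ℝ (fderiv ℝ P) y u v (fderiv ℝ g y w) +
      fderiv ℝ P y v (fderiv ℝ (fderiv ℝ g) y u w) = 0 := by
    intro u v w
    have h₁ := ((hP₁d hy).clm_apply (hasFDerivAt_const v y)).clm_apply
      ((hgd hy).clm_apply (hasFDerivAt_const w y))
    have h₃ := h₁.unique ((hasFDerivAt_const (0 : W) y).congr_of_eventuallyEq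
      (Filter.eventually_of_mem (hUn hy) fun z hz => hQ₁ z hz v w))
    have h₄ := DFunLike.congr_fun h₃ u
    rw [add_comm]
    simpa using h₄
  have hQskew : ∀ x u w, inner ℝ (fderiv ℝ P y x u) w = -inner ℝ u (fderiv ℝ P y x w) := by
    intro x u w
    have h₁ := ((hPd hy).clm_apply (hasFDerivAt_const u y)).inner ℝ (hasFDerivAt_const w y)
    have h₂ := ((hasFDerivAt_const u y).inner ℝ ((hPd hy).clm_apply (hasFDerivAt_const w y))).neg
    have h₃ := h₁.unique (h₂.congr_of_eventuallyEq
      (Filter.eventually_of_mem (hUn hy) fun z hz => hskew z hz u w))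
    have h₄ := DFunLike.congr_fun h₃ x
    simpa using h₄
  have h2 : minSmoothness ℝ 2 ≤ (∞ : WithTop ℕ∞) := by
    rw [minSmoothness_of_isRCLikeNormedField]
    exact WithTop.coe_le_coe.2 (le_top : (2 : ℕ∞) ≤ ⊤)
  have hgs : ∀ v w, fderiv ℝ (fderiv ℝ g) y v w = fderiv ℝ (fderiv ℝ g) y w v := fun v w =>
    (hgc hy).isSymmSndFDerivAt h2 v w
  have hPs : ∀ v w, fderiv ℝ (fderiv ℝ P) y v w = fderiv ℝ (fderiv ℝ P) y w v := fun v w =>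
    (hPc hy).isSymmSndFDerivAt h2 v w
  have hcod : ∀ x a b, fderiv ℝ P y x (fderiv ℝ (fderiv ℝ g) y a b) =
      fderiv ℝ P y a (fderiv ℝ (fderiv ℝ g) y x b) := fun x a b => by
    rw [eq_neg_of_add_eq_zero_right (hQ₂ a x b), hPs,
      eq_neg_of_add_eq_zero_right (hQ₂ x a b)]
  have hT : ∀ x a b c d, inner ℝ (fderiv ℝ P y x (fderiv ℝ (fderiv ℝ g) y a b))
      (fderiv ℝ (fderiv ℝ g) y c d) = 0 :=
    eq_zero_of_symm_of_skew_pairs (T := fun x a b c d =>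
      inner ℝ (fderiv ℝ P y x (fderiv ℝ (fderiv ℝ g) y a b)) (fderiv ℝ (fderiv ℝ g) y c d))
      (fun x a b c d => by simp only [hcod x a b]) (fun x a b c d => by simp only [hgs a b])
      (fun x a b c d => by simp only [hQskew x]; rw [neg_neg, ← hQskew x, real_inner_comm])
  have hQ₃ : ∀ x a b, fderiv ℝ P y x (fderiv ℝ (fderiv ℝ g) y a b) = 0 := fun x a b =>
    hspan y hy _ (fun w => by rw [real_inner_comm, hQskew, hQ₁ y hy, inner_zero_right, neg_zero])
      (fun v w => by rw [real_inner_comm, hT])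
  have hQ : fderiv ℝ P y = 0 := by
    ext x u : 2
    refine hspan y hy _ (fun w => ?_) (fun v w => ?_)
    · rw [real_inner_comm, hQskew, hQ₁ y hy, inner_zero_right, neg_zero]
    · rw [real_inner_comm, hQskew, hQ₃, inner_zero_right, neg_zero]
  exact hQ ▸ hPd hy

end Calculus

section Chart

open Topology FiberBundle

variable {E : Type*} [NormedAddCommGroup E] [NormedSpace ℝ E]
  {M : Type*} [TopologicalSpace M] [ChartedSpace E M] [IsManifold 𝓘(ℝ, E) ∞ M]
  {W : Type*} [NormedAddCommGroup W] [NormedSpace ℝ W]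

variable (E) in
/-- The coordinate vector field with constant coefficient `w` in the chart at `x₀`. -/
def coordField (x₀ : M) (w : E) (x : M) : TangentSpace 𝓘(ℝ, E) x :=
  extend E (E := fun x : M => TangentSpace 𝓘(ℝ, E) x) (x := x₀) w x

theorem coordField_eq {x₀ x : M} (hx : x ∈ (chartAt E x₀).source) (w : E) :
    coordField E x₀ w x =
      mfderiv 𝓘(ℝ, E) 𝓘(ℝ, E) (extChartAt 𝓘(ℝ, E) x₀).symm (extChartAt 𝓘(ℝ, E) x₀ x) w := by
  have h₁ : ((trivializationAt E (TangentSpace 𝓘(ℝ, E)) x₀) ⟨x₀, w⟩).2 = w :=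
    (tangentBundleCore 𝓘(ℝ, E) M).coordChange_self (achart E x₀) x₀ (mem_chart_source E x₀) w
  have h₂ := TangentBundle.symmL_trivializationAt (I := 𝓘(ℝ, E)) hx
  rw [ModelWithCorners.range_eq_univ, mfderivWithin_univ] at h₂
  rw [← h₂]
  change (trivializationAt E (TangentSpace 𝓘(ℝ, E)) x₀).symm x
    ((trivializationAt E (TangentSpace 𝓘(ℝ, E)) x₀) ⟨x₀, w⟩).2 = _
  rw [h₁]
  exact (Bundle.Trivialization.symmL_apply _ hx w).symm

theorem contMDiffAt_coordField {x₀ x : M} (hx : x ∈ (chartAt E x₀).source) (w : E) :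
    ContMDiffAt 𝓘(ℝ, E) (𝓘(ℝ, E).prod 𝓘(ℝ, E)) ∞
      (fun y => TotalSpace.mk' E (E := fun x : M => TangentSpace 𝓘(ℝ, E) x) y
        (coordField E x₀ w y)) x := by
  set t := trivializationAt E (TangentSpace 𝓘(ℝ, E)) x₀ with ht
  have hx' : x ∈ t.baseSet := hx
  rw [← contMDiffWithinAt_univ, t.contMDiffWithinAt_section _ hx', contMDiffWithinAt_univ]
  refine (contMDiffAt_const (c := (t ⟨x₀, w⟩).2)).congr_of_eventuallyEq ?_
  filter_upwards [t.open_baseSet.mem_nhds hx'] with y hy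
  simp [coordField, extend, ← ht, hy]

theorem mdifferentiableAt_extChartAt_symm' {x₀ : M} {y : E}
    (hy : y ∈ (extChartAt 𝓘(ℝ, E) x₀).target) :
    MDifferentiableAt 𝓘(ℝ, E) 𝓘(ℝ, E) (extChartAt 𝓘(ℝ, E) x₀).symm y := by
  have := mdifferentiableWithinAt_extChartAt_symm hy
  rwa [ModelWithCorners.range_eq_univ, mdifferentiableWithinAt_univ] at this

theorem contDiffAt_comp_extChartAt_symm {x₀ : M} {y : E}
    (hy : y ∈ (extChartAt 𝓘(ℝ, E) x₀).target) {h : M → W}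
    (hh : ContMDiffAt 𝓘(ℝ, E) 𝓘(ℝ, W) ∞ h ((extChartAt 𝓘(ℝ, E) x₀).symm y)) :
    ContDiffAt ℝ ∞ (fun z => h ((extChartAt 𝓘(ℝ, E) x₀).symm z)) y := by
  have h₁ := (contMDiffOn_extChartAt_symm (I := 𝓘(ℝ, E)) (n := ∞) x₀).contMDiffAt
    ((isOpen_extChartAt_target x₀).mem_nhds hy)
  exact (hh.comp y h₁).contDiffAt

/-- The coordinate expression of a differentiable function, differentiated along a coordinate
field. -/
theorem hasFDerivAt_comp_extChartAt_symm {x₀ : M} {y : E}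
    (hy : y ∈ (extChartAt 𝓘(ℝ, E) x₀).target) {h : M → W}
    (hh : MDifferentiableAt 𝓘(ℝ, E) 𝓘(ℝ, W) h ((extChartAt 𝓘(ℝ, E) x₀).symm y)) :
    DifferentiableAt ℝ (fun z => h ((extChartAt 𝓘(ℝ, E) x₀).symm z)) y ∧
    ∀ w, fderiv ℝ (fun z => h ((extChartAt 𝓘(ℝ, E) x₀).symm z)) y w =
      mvfderiv 𝓘(ℝ, E) h ((extChartAt 𝓘(ℝ, E) x₀).symm y)
        (coordField E x₀ w ((extChartAt 𝓘(ℝ, E) x₀).symm y)) := by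
  have h₁ := mdifferentiableAt_extChartAt_symm' hy
  have h₂ := hh.hasMFDerivAt.comp y h₁.hasMFDerivAt
  refine ⟨h₂.hasFDerivAt.differentiableAt, fun w => ?_⟩
  have hs : (extChartAt 𝓘(ℝ, E) x₀).symm y ∈ (chartAt E x₀).source := by
    rw [← extChartAt_source 𝓘(ℝ, E)]
    exact (extChartAt 𝓘(ℝ, E) x₀).map_target hy
  rw [coordField_eq hs, (extChartAt 𝓘(ℝ, E) x₀).right_inv hy]
  have h₃ : HasFDerivAt (fun z => h ((extChartAt 𝓘(ℝ, E) x₀).symm z)) (_ : E →L[ℝ] W) y :=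
    h₂.hasFDerivAt
  rw [h₃.fderiv]
  rfl

theorem contMDiffAt_mvfderiv_apply {f : M → W} (hf : ContMDiff 𝓘(ℝ, E) 𝓘(ℝ, W) ∞ f)
    {Y : ∀ x : M, TangentSpace 𝓘(ℝ, E) x} {x : M}
    (hY : ContMDiffAt 𝓘(ℝ, E) (𝓘(ℝ, E).prod 𝓘(ℝ, E)) ∞
      (fun y => TotalSpace.mk' E (E := fun x : M => TangentSpace 𝓘(ℝ, E) x) y (Y y)) x) :
    ContMDiffAt 𝓘(ℝ, E) 𝓘(ℝ, W) ∞ (fun y => mvfderiv 𝓘(ℝ, E) f y (Y y)) x := by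
  have h₁ : ContMDiff 𝓘(ℝ, E).tangent 𝓘(ℝ, W).tangent ∞ (tangentMap 𝓘(ℝ, E) 𝓘(ℝ, W) f) :=
    hf.contMDiff_tangentMap (by simp)
  have h₂ := contMDiff_snd_tangentBundle_modelSpace (n := ∞) W 𝓘(ℝ, W)
  exact (h₂.contMDiffAt.comp _ h₁.contMDiffAt).comp x hY

theorem mdifferentiableAt_mvfderiv_apply {f : M → W} (hf : ContMDiff 𝓘(ℝ, E) 𝓘(ℝ, W) ∞ f)
    {Y : ∀ x : M, TangentSpace 𝓘(ℝ, E) x} {x : M}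
    (hY : MDifferentiableAt 𝓘(ℝ, E) (𝓘(ℝ, E).prod 𝓘(ℝ, E))
      (fun y => TotalSpace.mk' E (E := fun x : M => TangentSpace 𝓘(ℝ, E) x) y (Y y)) x) :
    MDifferentiableAt 𝓘(ℝ, E) 𝓘(ℝ, W) (fun y => mvfderiv 𝓘(ℝ, E) f y (Y y)) x := by
  have h₁ : ContMDiff 𝓘(ℝ, E).tangent 𝓘(ℝ, W).tangent ∞ (tangentMap 𝓘(ℝ, E) 𝓘(ℝ, W) f) :=
    hf.contMDiff_tangentMap (by simp)
  have h₂ := contMDiff_snd_tangentBundle_modelSpace (n := ∞) W 𝓘(ℝ, W)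
  exact ((h₂.comp h₁).contMDiffAt.mdifferentiableAt (by simp)).comp x hY

/-- Coordinate fields commute at the centre of the chart. -/
theorem mlieBracket_coordField (x₀ : M) (v w : E) :
    VectorField.mlieBracket 𝓘(ℝ, E) (coordField E x₀ v) (coordField E x₀ w) x₀ = 0 := by
  have key : ∀ u : E, VectorField.mpullbackWithin 𝓘(ℝ, E) 𝓘(ℝ, E) (extChartAt 𝓘(ℝ, E) x₀).symm
      (coordField E x₀ u) (Set.range 𝓘(ℝ, E)) =ᶠ[𝓝 (extChartAt 𝓘(ℝ, E) x₀ x₀)] fun _ => u := by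
    intro u
    filter_upwards [(isOpen_extChartAt_target x₀).mem_nhds (mem_extChartAt_target x₀)] with y hy
    have hs : (extChartAt 𝓘(ℝ, E) x₀).symm y ∈ (chartAt E x₀).source := by
      rw [← extChartAt_source 𝓘(ℝ, E)]
      exact (extChartAt 𝓘(ℝ, E) x₀).map_target hy
    rw [VectorField.mpullbackWithin_apply, coordField_eq hs,
      (extChartAt 𝓘(ℝ, E) x₀).right_inv hy]
    have hi := isInvertible_mfderivWithin_extChartAt_symm (I := 𝓘(ℝ, E)) hy
    rw [ModelWithCorners.range_eq_univ, mfderivWithin_univ] at hi ⊢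
    exact hi.inverse_apply_self u
  rw [VectorField.mlieBracket, VectorField.mlieBracketWithin_apply,
    Filter.EventuallyEq.lieBracketWithin_vectorField_eq_nhds (key v) (key w)]
  simp only [VectorField.lieBracketWithin, fderivWithin_fun_const, Pi.zero_apply,
    zero_apply, sub_self]
  exact ContinuousLinearMap.map_zero _

end Chart

section Gauss

open Topology FiberBundle

variable {E : Type*} [NormedAddCommGroup E] [NormedSpace ℝ E]
  {M : Type*} [TopologicalSpace M] [ChartedSpace E M] [IsManifold 𝓘(ℝ, E) ∞ M]
  {W : Type*} [NormedAddCommGroup W] [InnerProductSpace ℝ W]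

/-- The second derivative of the coordinate expression of `f`. -/
theorem fderiv_fderiv_comp_extChartAt_symm {f : M → W} (hf : ContMDiff 𝓘(ℝ, E) 𝓘(ℝ, W) ∞ f) {x₀ : M}
    {y : E} (hy : y ∈ (extChartAt 𝓘(ℝ, E) x₀).target) (v w : E) :
    fderiv ℝ (fderiv ℝ fun z => f ((extChartAt 𝓘(ℝ, E) x₀).symm z)) y v w =
      mvfderiv 𝓘(ℝ, E) (fun x => mvfderiv 𝓘(ℝ, E) f x (coordField E x₀ w x))
        ((extChartAt 𝓘(ℝ, E) x₀).symm y)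
        (coordField E x₀ v ((extChartAt 𝓘(ℝ, E) x₀).symm y)) := by
  have hU := (isOpen_extChartAt_target x₀).mem_nhds hy
  have hs : (extChartAt 𝓘(ℝ, E) x₀).symm y ∈ (chartAt E x₀).source := by
    rw [← extChartAt_source 𝓘(ℝ, E)]
    exact (extChartAt 𝓘(ℝ, E) x₀).map_target hy
  have hg : ContDiffAt ℝ ∞ (fderiv ℝ fun z => f ((extChartAt 𝓘(ℝ, E) x₀).symm z)) y :=
    (contDiffAt_comp_extChartAt_symm hy hf.contMDiffAt).fderiv_right (by simp)
  have h₁ := (hg.differentiableAt (by simp)).hasFDerivAt.clm_apply (hasFDerivAt_const w y)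
  have h₂ := (hasFDerivAt_comp_extChartAt_symm hy ((contMDiffAt_mvfderiv_apply hf
    (contMDiffAt_coordField hs w)).mdifferentiableAt (by simp))).2 v
  rw [← h₂, ← Filter.EventuallyEq.fderiv_eq (Filter.eventually_of_mem hU fun z hz =>
    (hasFDerivAt_comp_extChartAt_symm hz (hf.mdifferentiable (by simp) _)).2 w), h₁.fderiv]
  simp

theorem mvfderiv_inner {g h : M → W} {x : M} (hg : MDifferentiableAt 𝓘(ℝ, E) 𝓘(ℝ, W) g x)
    (hh : MDifferentiableAt 𝓘(ℝ, E) 𝓘(ℝ, W) h x) (v : TangentSpace 𝓘(ℝ, E) x) :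
    mvfderiv 𝓘(ℝ, E) (fun y => (inner ℝ (g y) (h y) : ℝ)) x v =
      inner ℝ (mvfderiv 𝓘(ℝ, E) g x v) (h x) + inner ℝ (g x) (mvfderiv 𝓘(ℝ, E) h x v) := by
  have hd : MDifferentiableAt 𝓘(ℝ, E) 𝓘(ℝ, ℝ) (fun y => (inner ℝ (g y) (h y) : ℝ)) x :=
    (contDiff_inner (𝕜 := ℝ) (E := W) (n := 1)).contDiffAt.differentiableAt
      (by simp) |>.comp_mdifferentiableAt (hg.prodMk_space hh)
  have hy := mem_extChartAt_target (I := 𝓘(ℝ, E)) x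
  rw [← extChartAt_to_inv (I := 𝓘(ℝ, E)) x] at hg hh hd
  have h₁ := hasFDerivAt_comp_extChartAt_symm hy hg
  have h₂ := hasFDerivAt_comp_extChartAt_symm hy hh
  obtain ⟨u, rfl⟩ : ∃ u : E, u = v := ⟨v, rfl⟩
  have h₃ := (hasFDerivAt_comp_extChartAt_symm hy hd).2 u
  have h₄ := h₁.2 u
  have h₅ := h₂.2 u
  rw [fderiv_inner_apply ℝ h₁.1 h₂.1, extChartAt_to_inv] at h₃
  rw [extChartAt_to_inv] at h₄ h₅
  have hu : coordField E x u x = u := extend_apply_self _ _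
  rw [hu] at h₃ h₄ h₅
  rw [← h₃, h₄, h₅, add_comm]

/-- The difference of the flat derivative of `f_* Y` and of `f_* (∇ Y)` is tensorial in `Y`. -/
theorem tensorialAt_mvfderiv_sub_cov {f : M → W} (hf : ContMDiff 𝓘(ℝ, E) 𝓘(ℝ, W) ∞ f)
    (cov : CovariantDerivative 𝓘(ℝ, E) E (fun x : M => TangentSpace 𝓘(ℝ, E) x))
    (x : M) (v : TangentSpace 𝓘(ℝ, E) x) :
    TensorialAt 𝓘(ℝ, E) E (fun Y : ∀ x : M, TangentSpace 𝓘(ℝ, E) x =>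
      mvfderiv 𝓘(ℝ, E) (fun y => mvfderiv 𝓘(ℝ, E) f y (Y y)) x v -
        mvfderiv 𝓘(ℝ, E) f x (cov Y x v)) x where
  smul {a Y} ha hY := by
    have h := mvfderiv_smul ha (mdifferentiableAt_mvfderiv_apply hf hY)
    have h' := congrArg (fun L => L v) (cov.isCovariantDerivativeOn.leibniz hY ha)
    have e : (fun y => mvfderiv 𝓘(ℝ, E) f y ((a • Y) y)) =
        a • fun y => mvfderiv 𝓘(ℝ, E) f y (Y y) :=
      funext fun y => (mvfderiv 𝓘(ℝ, E) f y).map_smul (a y) (Y y)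
    rw [e, h]
    simp only [h', add_apply, smul_apply, ContinuousLinearMap.smulRight_apply, map_add, map_smul]
    module
  add {Y Z} hY hZ := by
    have h := mvfderiv_add (mdifferentiableAt_mvfderiv_apply hf hY)
      (mdifferentiableAt_mvfderiv_apply hf hZ)
    have h' := congrArg (fun L => L v) (cov.isCovariantDerivativeOn.add hY hZ)
    have e : (fun y => mvfderiv 𝓘(ℝ, E) f y ((Y + Z) y)) =
        (fun y => mvfderiv 𝓘(ℝ, E) f y (Y y)) + fun y => mvfderiv 𝓘(ℝ, E) f y (Z y) :=
      funext fun y => (mvfderiv 𝓘(ℝ, E) f y).map_add (Y y) (Z y)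
    rw [e, h]
    simp only [h', add_apply, map_add]
    module

variable [FiniteDimensional ℝ E] [FiniteDimensional ℝ W]
  [RiemannianBundle (fun x : M => TangentSpace 𝓘(ℝ, E) x)]
  {cov : CovariantDerivative 𝓘(ℝ, E) E (fun x : M => TangentSpace 𝓘(ℝ, E) x)} {f : M → W}

/-- **Gauss formula**. -/
theorem mvfderiv_eq_cov_add_secondFundamentalForm (hf : IsIsometricImmersion 𝓘(ℝ, E) f)
    (hcov : IsLeviCivita 𝓘(ℝ, E) cov) {Y : ∀ x : M, TangentSpace 𝓘(ℝ, E) x} {x : M}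
    (hY : MDifferentiableAt 𝓘(ℝ, E) (𝓘(ℝ, E).prod 𝓘(ℝ, E))
      (fun y => TotalSpace.mk' E (E := fun x : M => TangentSpace 𝓘(ℝ, E) x) y (Y y)) x)
    (v : TangentSpace 𝓘(ℝ, E) x) :
    mvfderiv 𝓘(ℝ, E) (fun y => mvfderiv 𝓘(ℝ, E) f y (Y y)) x v =
      mvfderiv 𝓘(ℝ, E) f x (cov Y x v) + (secondFundamentalForm 𝓘(ℝ, E) f x v (Y x) : W) := by
  set D : E → E → W := fun v w =>
    mvfderiv 𝓘(ℝ, E) (fun y => mvfderiv 𝓘(ℝ, E) f y (coordField E x w y)) x v with hD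
  set S : E → E → W := fun v w => D v w - mvfderiv 𝓘(ℝ, E) f x (cov (coordField E x w) x v) with hS
  have hX : ∀ w : E, MDifferentiableAt 𝓘(ℝ, E) (𝓘(ℝ, E).prod 𝓘(ℝ, E))
      (fun y => TotalSpace.mk' E (E := fun x : M => TangentSpace 𝓘(ℝ, E) x) y
        (coordField E x w y)) x := fun w =>
    (contMDiffAt_coordField (mem_chart_source E x) w).mdifferentiableAt (by simp)
  have hXx : ∀ w : E, coordField E x w x = w := fun w => extend_apply_self _ _
  have hDs : ∀ v w, D v w = D w v := by
    intro v w
    have hy := mem_extChartAt_target (I := 𝓘(ℝ, E)) x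
    have h₁ := fderiv_fderiv_comp_extChartAt_symm hf.smooth hy v w
    have h₂ := fderiv_fderiv_comp_extChartAt_symm hf.smooth hy w v
    rw [extChartAt_to_inv, hXx] at h₁ h₂
    refine h₁.symm.trans (Eq.trans ?_ h₂)
    have hg := contDiffAt_comp_extChartAt_symm hy hf.smooth.contMDiffAt
    refine hg.isSymmSndFDerivAt ?_ v w
    rw [minSmoothness_of_isRCLikeNormedField]
    exact WithTop.coe_le_coe.2 (le_top : (2 : ℕ∞) ≤ ⊤)
  have hSs : ∀ v w, S v w = S w v := by
    intro v w
    have ht := cov.torsion_eq_zero_iff.1 hcov.torsion_eq_zero (hX v) (hX w)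
    rw [mlieBracket_coordField, hXx, hXx, sub_eq_zero] at ht
    simp only [hS, hDs v w, ht]
  have hSm : ∀ a b c : E, inner ℝ (S a b) (mvfderiv 𝓘(ℝ, E) f x c) =
      -inner ℝ (S a c) (mvfderiv 𝓘(ℝ, E) f x b) := by
    intro a b c
    have h₁ := hcov.metric _ _ x (hX b) (hX c) a
    have h₂ : (fun y => (inner ℝ (coordField E x b y) (coordField E x c y) : ℝ)) = fun y =>
        inner ℝ (mvfderiv 𝓘(ℝ, E) f y (coordField E x b y))
          (mvfderiv 𝓘(ℝ, E) f y (coordField E x c y)) :=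
      funext fun y => (hf.isometric y _ _).symm
    rw [h₂] at h₁
    have hd := fun w => mdifferentiableAt_mvfderiv_apply hf.smooth (hX w)
    have h₃ := mvfderiv_inner (hd b) (hd c) a
    rw [h₃, ← hf.isometric, ← hf.isometric, hXx, hXx] at h₁
    have h₄ : inner ℝ (D a b) (mvfderiv 𝓘(ℝ, E) f x c) +
          inner ℝ (mvfderiv 𝓘(ℝ, E) f x b) (D a c) =
        inner ℝ (mvfderiv 𝓘(ℝ, E) f x (cov (coordField E x b) x a)) (mvfderiv 𝓘(ℝ, E) f x c) +
          inner ℝ (mvfderiv 𝓘(ℝ, E) f x b)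
            (mvfderiv 𝓘(ℝ, E) f x (cov (coordField E x c) x a)) := h₁
    have h₅ := real_inner_comm (D a c) (mvfderiv 𝓘(ℝ, E) f x b)
    have h₆ := real_inner_comm (mvfderiv 𝓘(ℝ, E) f x (cov (coordField E x c) x a))
      (mvfderiv 𝓘(ℝ, E) f x b)
    simp only [hS, inner_sub_left]
    linarith
  have hSn : ∀ a b, S a b ∈ normalSpace 𝓘(ℝ, E) f x := by
    intro a b
    rw [normalSpace, Submodule.mem_orthogonal]
    rintro _ ⟨c, rfl⟩
    rw [real_inner_comm]
    exact eq_zero_of_symm_of_skew (T := fun a b c : E => inner ℝ (S a b) (mvfderiv 𝓘(ℝ, E) f x c))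
      (fun a b c => by simp only [hSs a b]) hSm a b c
  have hsff : (secondFundamentalForm 𝓘(ℝ, E) f x v (Y x) : W) = S v (Y x) := by
    have h₁ : D v (Y x) = mvfderiv 𝓘(ℝ, E) f x (cov (coordField E x (Y x)) x v) + S v (Y x) := by
      simp only [hS, add_sub_cancel]
    change ((normalSpace 𝓘(ℝ, E) f x).orthogonalProjectionOnto (D v (Y x)) : W) = _
    have h₂ : (normalSpace 𝓘(ℝ, E) f x).orthogonalProjectionOnto
        (mvfderiv 𝓘(ℝ, E) f x (cov (coordField E x (Y x)) x v)) = 0 :=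
      Submodule.orthogonalProjectionOnto_orthogonal_apply_eq_zero ⟨_, rfl⟩
    rw [h₁, map_add, h₂, zero_add]
    exact congrArg Subtype.val
      (Submodule.orthogonalProjectionOnto_mem_subspace_eq_self ⟨S v (Y x), hSn v (Y x)⟩)
  have hp := (tensorialAt_mvfderiv_sub_cov hf.smooth cov x v).pointwise hY (hX (Y x))
    (hXx (Y x)).symm
  rw [hsff]
  exact eq_add_of_sub_eq' hp

theorem secondFundamentalForm_neg_right (hf : IsIsometricImmersion 𝓘(ℝ, E) f)
    (hcov : IsLeviCivita 𝓘(ℝ, E) cov) {x : M} (v w : TangentSpace 𝓘(ℝ, E) x) :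
    secondFundamentalForm 𝓘(ℝ, E) f x v (-w) = -secondFundamentalForm 𝓘(ℝ, E) f x v w := by
  have hY : MDifferentiableAt 𝓘(ℝ, E) (𝓘(ℝ, E).prod 𝓘(ℝ, E))
      (fun y => TotalSpace.mk' E (E := fun x : M => TangentSpace 𝓘(ℝ, E) x) y
        (extend E w y)) x := mdifferentiableAt_extend ..
  have hc : MDifferentiableAt 𝓘(ℝ, E) 𝓘(ℝ, ℝ) (fun _ : M => (-1 : ℝ)) x := mdifferentiableAt_const
  have h := (tensorialAt_mvfderiv_sub_cov hf.smooth cov x v).smul hc hY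
  rw [mvfderiv_eq_cov_add_secondFundamentalForm hf hcov hY,
    mvfderiv_eq_cov_add_secondFundamentalForm hf hcov (hc.smul_section hY), add_sub_cancel_left,
    add_sub_cancel_left, Pi.smul_apply', extend_apply_self, neg_one_smul, neg_one_smul] at h
  exact Subtype.ext h

end Gauss

section AmbientStructure

open Topology FiberBundle

/-- Complex structures on the domain and on the normal space of an injective linear map assemble
to a complex structure on the target. -/
theorem exists_ambient_complexStructure {V W : Type*} [AddCommGroup V] [Module ℝ V]
    [NormedAddCommGroup W] [InnerProductSpace ℝ W] [FiniteDimensional ℝ W] (L : V →ₗ[ℝ] W)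
    (hL : Function.Injective L) (j : V →ₗ[ℝ] V) (hj : ∀ v, j (j v) = -v)
    (hjL : ∀ v w, inner ℝ (L (j v)) (L (j w)) = inner ℝ (L v) (L w))
    (T : L.rangeᗮ ≃ₗᵢ[ℝ] L.rangeᗮ) (hT : ∀ ξ, T (T ξ) = -ξ) :
    ∃ P : W →L[ℝ] W, (∀ w, P (P w) = -w) ∧ (∀ u w, inner ℝ (P u) (P w) = inner ℝ u w) ∧
      (∀ v, P (L v) = L (j v)) ∧ ∀ ξ : L.rangeᗮ, P ξ = T ξ := by
  let e := LinearEquiv.ofInjective L hL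
  let A : L.range →ₗ[ℝ] W := L ∘ₗ j ∘ₗ e.symm.toLinearMap
  let P : W →ₗ[ℝ] W := A ∘ₗ L.range.orthogonalProjectionOnto.toLinearMap +
    L.rangeᗮ.subtype ∘ₗ T.toLinearEquiv.toLinearMap ∘ₗ
      L.rangeᗮ.orthogonalProjectionOnto.toLinearMap
  have hP₁ : ∀ v, P (L v) = L (j v) := fun v => by
    have h₁ : L.range.orthogonalProjectionOnto (L v) = e v :=
      Submodule.orthogonalProjectionOnto_mem_subspace_eq_self (e v)
    have h₂ : L.rangeᗮ.orthogonalProjectionOnto (L v) = 0 :=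
      Submodule.orthogonalProjectionOnto_orthogonal_apply_eq_zero ⟨v, rfl⟩
    simp [P, A, h₁, h₂]
  have hP₂ : ∀ ξ : L.rangeᗮ, P ξ = T ξ := fun ξ => by
    have h₁ : L.range.orthogonalProjectionOnto (ξ : W) = 0 :=
      Submodule.orthogonalProjectionOnto_apply_of_mem_orthogonal ξ.2
    have h₂ : L.rangeᗮ.orthogonalProjectionOnto (ξ : W) = ξ :=
      Submodule.orthogonalProjectionOnto_mem_subspace_eq_self ξ
    simp [P, h₁, h₂]
  have hdec : ∀ w : W, ∃ v, ∃ ξ : L.rangeᗮ, w = L v + ξ := fun w => by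
    obtain ⟨_, ⟨v, rfl⟩, ξ, hξ, h⟩ := L.range.exists_add_mem_mem_orthogonal w
    exact ⟨v, ⟨ξ, hξ⟩, h⟩
  have hn : ∀ v, ∀ ξ : L.rangeᗮ, inner ℝ (L v) (ξ : W) = 0 := fun v ξ => ξ.2 _ ⟨v, rfl⟩
  have hn' : ∀ v, ∀ ξ : L.rangeᗮ, inner ℝ (ξ : W) (L v) = 0 := fun v ξ => by
    rw [real_inner_comm, hn]
  refine ⟨LinearMap.toContinuousLinearMap P, fun w => ?_, fun u w => ?_, hP₁, hP₂⟩
  · obtain ⟨v, ξ, rfl⟩ := hdec w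
    change P (P _) = _
    rw [map_add, hP₁, hP₂, map_add, hP₁, hP₂, hj, hT, map_neg, Submodule.coe_neg, neg_add]
  · obtain ⟨v, ξ, rfl⟩ := hdec w
    obtain ⟨v', ξ', rfl⟩ := hdec u
    change inner ℝ (P _) (P _) = _
    simp only [map_add, hP₁, hP₂, inner_add_left, inner_add_right, hn, hn', hjL]
    rw [← Submodule.coe_inner, ← Submodule.coe_inner, T.inner_map_map]

variable {E : Type*} [NormedAddCommGroup E] [NormedSpace ℝ E] [FiniteDimensional ℝ E]
  {M : Type*} [TopologicalSpace M] [ChartedSpace E M] [IsManifold 𝓘(ℝ, E) ∞ M]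
  [RiemannianBundle (fun x : M => TangentSpace 𝓘(ℝ, E) x)]
  {W : Type*} [NormedAddCommGroup W] [InnerProductSpace ℝ W] [FiniteDimensional ℝ W]
  {J : ∀ x : M, TangentSpace 𝓘(ℝ, E) x →L[ℝ] TangentSpace 𝓘(ℝ, E) x} {f : M → W}
  {𝒥 : ∀ x : M, normalSpace 𝓘(ℝ, E) f x ≃ₗᵢ[ℝ] normalSpace 𝓘(ℝ, E) f x}

/-- An isometry of the normal bundle intertwining `J` squares to `-1` on the first normal space. -/
theorem normal_isometry_sq (hJ : IsKaehlerStructure 𝓘(ℝ, E) J)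
    (hN : ∀ x : M, firstNormalSpace 𝓘(ℝ, E) f x = ⊤)
    (hα : ∀ (x : M) (v w : TangentSpace 𝓘(ℝ, E) x),
      𝒥 x (secondFundamentalForm 𝓘(ℝ, E) f x v w) = secondFundamentalForm 𝓘(ℝ, E) f x v (J x w))
    (hneg : ∀ (x : M) (v w : TangentSpace 𝓘(ℝ, E) x),
      secondFundamentalForm 𝓘(ℝ, E) f x v (-w) = -secondFundamentalForm 𝓘(ℝ, E) f x v w)
    (x : M) (ξ : normalSpace 𝓘(ℝ, E) f x) : 𝒥 x (𝒥 x ξ) = -ξ := by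
  have hξ : ξ ∈ firstNormalSpace 𝓘(ℝ, E) f x := hN x ▸ Submodule.mem_top
  induction hξ using Submodule.span_induction with
  | mem _ h =>
    obtain ⟨v, w, rfl⟩ := h
    rw [hα, hα, hJ.sq, hneg]
  | zero => simp
  | add a b _ _ ha hb => rw [map_add, map_add, ha, hb, neg_add]
  | smul c a _ ha => rw [map_smul, map_smul, ha, smul_neg]

/-- The ambient complex structure extending `J` and `𝒥` commutes with differentiation of tangent
fields. -/
theorem ambient_apply_mvfderiv (hJ : IsKaehlerStructure 𝓘(ℝ, E) J)
    (hf : IsIsometricImmersion 𝓘(ℝ, E) f)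
    (hα : ∀ (x : M) (v w : TangentSpace 𝓘(ℝ, E) x),
      𝒥 x (secondFundamentalForm 𝓘(ℝ, E) f x v w) = secondFundamentalForm 𝓘(ℝ, E) f x v (J x w))
    {P : M → W →L[ℝ] W}
    (hP₁ : ∀ (x : M) (v : TangentSpace 𝓘(ℝ, E) x),
      P x (mvfderiv 𝓘(ℝ, E) f x v) = mvfderiv 𝓘(ℝ, E) f x (J x v))
    (hP₂ : ∀ (x : M) (ξ : normalSpace 𝓘(ℝ, E) f x), P x ξ = 𝒥 x ξ)
    {Y : ∀ x : M, TangentSpace 𝓘(ℝ, E) x} {x : M}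
    (hY : MDifferentiableAt 𝓘(ℝ, E) (𝓘(ℝ, E).prod 𝓘(ℝ, E))
      (fun y => TotalSpace.mk' E (E := fun x : M => TangentSpace 𝓘(ℝ, E) x) y (Y y)) x)
    (v : TangentSpace 𝓘(ℝ, E) x) :
    P x (mvfderiv 𝓘(ℝ, E) (fun y => mvfderiv 𝓘(ℝ, E) f y (Y y)) x v) =
      mvfderiv 𝓘(ℝ, E) (fun y => mvfderiv 𝓘(ℝ, E) f y (J y (Y y))) x v := by
  obtain ⟨cov, hcov, hpar⟩ := hJ.parallel
  have hJY : MDifferentiableAt 𝓘(ℝ, E) (𝓘(ℝ, E).prod 𝓘(ℝ, E))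
      (fun y => TotalSpace.mk' E (E := fun x : M => TangentSpace 𝓘(ℝ, E) x) y (J y (Y y))) x :=
    (hJ.smooth.mdifferentiable (by simp) x).clm_bundle_apply hY
  rw [mvfderiv_eq_cov_add_secondFundamentalForm hf hcov hY,
    mvfderiv_eq_cov_add_secondFundamentalForm hf hcov hJY, map_add, hP₁, hP₂, hα, hpar Y x hY]

/-- The ambient complex structure extending `J` and `𝒥` is locally constant. -/
theorem isLocallyConstant_ambient (hJ : IsKaehlerStructure 𝓘(ℝ, E) J)
    (hf : IsIsometricImmersion 𝓘(ℝ, E) f)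
    (hN : ∀ x : M, firstNormalSpace 𝓘(ℝ, E) f x = ⊤)
    {P : M → W →L[ℝ] W} (hskew : ∀ x u w, inner ℝ (P x u) w = -inner ℝ u (P x w))
    (hP₁ : ∀ (x : M) (v : TangentSpace 𝓘(ℝ, E) x),
      P x (mvfderiv 𝓘(ℝ, E) f x v) = mvfderiv 𝓘(ℝ, E) f x (J x v))
    (hP : ∀ (Y : ∀ x : M, TangentSpace 𝓘(ℝ, E) x) (x : M),
      MDifferentiableAt 𝓘(ℝ, E) (𝓘(ℝ, E).prod 𝓘(ℝ, E))
        (fun y => TotalSpace.mk' E (E := fun x : M => TangentSpace 𝓘(ℝ, E) x) y (Y y)) x →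
      ∀ v : TangentSpace 𝓘(ℝ, E) x,
        P x (mvfderiv 𝓘(ℝ, E) (fun y => mvfderiv 𝓘(ℝ, E) f y (Y y)) x v) =
          mvfderiv 𝓘(ℝ, E) (fun y => mvfderiv 𝓘(ℝ, E) f y (J y (Y y))) x v) :
    IsLocallyConstant P := by
  obtain ⟨cov, hcov, -⟩ := hJ.parallel
  refine (IsLocallyConstant.iff_eventually_eq P).2 fun x₀ => ?_
  set ψ := (extChartAt 𝓘(ℝ, E) x₀).symm with hψ
  set U := (extChartAt 𝓘(ℝ, E) x₀).target with hU
  have hUo : IsOpen U := isOpen_extChartAt_target x₀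
  have hs : ∀ y ∈ U, ψ y ∈ (chartAt E x₀).source := fun y hy => by
    rw [← extChartAt_source 𝓘(ℝ, E)]
    exact (extChartAt 𝓘(ℝ, E) x₀).map_target hy
  have hX : ∀ y ∈ U, ∀ w, ContMDiffAt 𝓘(ℝ, E) (𝓘(ℝ, E).prod 𝓘(ℝ, E)) ∞
      (fun y => TotalSpace.mk' E (E := fun x : M => TangentSpace 𝓘(ℝ, E) x) y
        (coordField E x₀ w y)) (ψ y) := fun y hy w => contMDiffAt_coordField (hs y hy) w
  have hJX : ∀ y ∈ U, ∀ w, ContMDiffAt 𝓘(ℝ, E) 𝓘(ℝ, W) ∞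
      (fun x => mvfderiv 𝓘(ℝ, E) f x (J x (coordField E x₀ w x))) (ψ y) := fun y hy w =>
    contMDiffAt_mvfderiv_apply hf.smooth ((hJ.smooth _).clm_bundle_apply (hX y hy w))
  set g : E → W := fun z => f (ψ z) with hg
  have hgs : ContDiffOn ℝ ∞ g U := fun y hy =>
    (contDiffAt_comp_extChartAt_symm hy hf.smooth.contMDiffAt).contDiffWithinAt
  have hg₁ : ∀ y ∈ U, ∀ w, fderiv ℝ g y w = mvfderiv 𝓘(ℝ, E) f (ψ y) (coordField E x₀ w (ψ y)) :=
    fun y hy => (hasFDerivAt_comp_extChartAt_symm hy (hf.smooth.mdifferentiable (by simp) _)).2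
  have hg₂ : ∀ y ∈ U, ∀ v w, fderiv ℝ (fderiv ℝ g) y v w =
      mvfderiv 𝓘(ℝ, E) (fun x => mvfderiv 𝓘(ℝ, E) f x (coordField E x₀ w x)) (ψ y)
        (coordField E x₀ v (ψ y)) := fun y hy => fderiv_fderiv_comp_extChartAt_symm hf.smooth hy
  set k : E → E →L[ℝ] W := fun z => (P (ψ z)).comp (fderiv ℝ g z) with hk
  have hk₁ : ∀ y ∈ U, ∀ w, k y w =
      mvfderiv 𝓘(ℝ, E) f (ψ y) (J (ψ y) (coordField E x₀ w (ψ y))) := fun y hy w => by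
    rw [hk, ContinuousLinearMap.comp_apply, hg₁ y hy, hP₁]
  have hks : ContDiffOn ℝ ∞ k U := contDiffOn_clm_apply.2 fun w y hy =>
    (contDiffAt_comp_extChartAt_symm hy (hJX y hy w)).contDiffWithinAt.congr_of_mem
      (fun z hz => hk₁ z hz w) hy
  have hk₂ : ∀ y ∈ U, ∀ v w, P (ψ y) (fderiv ℝ (fderiv ℝ g) y v w) = fderiv ℝ k y v w := by
    intro y hy v w
    have h₁ := ((hks.contDiffAt (hUo.mem_nhds hy)).differentiableAt
      (by simp)).hasFDerivAt.clm_apply (hasFDerivAt_const w y)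
    have h₂ := (hasFDerivAt_comp_extChartAt_symm hy
      ((hJX y hy w).mdifferentiableAt (by simp))).2 v
    have h₃ := Filter.EventuallyEq.fderiv_eq (𝕜 := ℝ)
      (Filter.eventually_of_mem (hUo.mem_nhds hy) fun z hz => hk₁ z hz w)
    rw [hg₂ y hy, hP _ _ ((hX y hy w).mdifferentiableAt (by simp)), ← h₂, ← h₃, h₁.fderiv]
    simp
  have hsurj : ∀ y ∈ U, ∀ v : TangentSpace 𝓘(ℝ, E) (ψ y), ∃ w : E,
      coordField E x₀ w (ψ y) = v := by
    intro y hy v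
    have hi := isInvertible_mfderivWithin_extChartAt_symm (I := 𝓘(ℝ, E)) hy
    rw [ModelWithCorners.range_eq_univ, mfderivWithin_univ] at hi
    obtain ⟨w, hw⟩ := hi.bijective.2 v
    have h := coordField_eq (hs y hy) w
    rw [(extChartAt 𝓘(ℝ, E) x₀).right_inv hy] at h
    exact ⟨w, h.trans hw⟩
  have hspan : ∀ y ∈ U, ∀ u : W, (∀ w, inner ℝ (fderiv ℝ g y w) u = 0) →
      (∀ v w, inner ℝ (fderiv ℝ (fderiv ℝ g) y v w) u = 0) → u = 0 := by
    intro y hy u h₁ h₂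
    have hu : u ∈ normalSpace 𝓘(ℝ, E) f (ψ y) := by
      rw [normalSpace, Submodule.mem_orthogonal]
      rintro _ ⟨v, rfl⟩
      obtain ⟨w, rfl⟩ := hsurj y hy v
      exact hg₁ y hy w ▸ h₁ w
    have hu' : (⟨u, hu⟩ : normalSpace 𝓘(ℝ, E) f (ψ y)) ∈
        (firstNormalSpace 𝓘(ℝ, E) f (ψ y))ᗮ := by
      rw [firstNormalSpace, Submodule.mem_orthogonal]
      intro η hη
      induction hη using Submodule.span_induction with
      | mem _ h =>
        obtain ⟨v, w, rfl⟩ := h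
        obtain ⟨v, rfl⟩ := hsurj y hy v
        obtain ⟨w, rfl⟩ := hsurj y hy w
        have h₃ := h₂ v w
        rw [hg₂ y hy, mvfderiv_eq_cov_add_secondFundamentalForm hf hcov
          ((hX y hy w).mdifferentiableAt (by simp)), inner_add_left] at h₃
        have h₄ := hu _ ⟨cov (coordField E x₀ w) (ψ y) (coordField E x₀ v (ψ y)), rfl⟩
        exact (add_eq_right.2 h₄).symm.trans h₃
      | zero => simp
      | add a b _ _ ha hb => rw [inner_add_left, ha, hb, add_zero]
      | smul c a _ ha => rw [inner_smul_left, ha, mul_zero]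
    rw [hN, Submodule.top_orthogonal_eq_bot, Submodule.mem_bot] at hu'
    exact congrArg Subtype.val hu'
  have hder : ∀ y ∈ U, HasFDerivAt (fun z => P (ψ z)) (0 : E →L[ℝ] W →L[ℝ] W) y := fun y hy =>
    hasFDerivAt_zero_of_second_order hUo hgs hks (fun y _ => hskew (ψ y)) (fun _ _ _ => rfl)
      hk₂ hspan hy
  obtain ⟨r, hr, hball⟩ := Metric.isOpen_iff.1 hUo _ (mem_extChartAt_target (I := 𝓘(ℝ, E)) x₀)
  have hb : Metric.ball (extChartAt 𝓘(ℝ, E) x₀ x₀) r ∈ 𝓝 (extChartAt 𝓘(ℝ, E) x₀ x₀) :=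
    Metric.ball_mem_nhds _ hr
  filter_upwards [(continuousAt_extChartAt (I := 𝓘(ℝ, E)) x₀).preimage_mem_nhds hb,
    extChartAt_source_mem_nhds (I := 𝓘(ℝ, E)) x₀] with x hx hxs
  have := Metric.isOpen_ball.is_const_of_fderiv_eq_zero (convex_ball _ r).isPreconnected
    (f := fun z => P (ψ z)) (𝕜 := ℝ)
    (fun z hz => (hder z (hball hz)).differentiableAt.differentiableWithinAt)
    (fun z hz => (hder z (hball hz)).fderiv) hx (Metric.mem_ball_self hr)
  simpa only [hψ, (extChartAt 𝓘(ℝ, E) x₀).left_inv hxs, extChartAt_to_inv] using this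

/-- If the normal bundle is spanned by the second fundamental form and carries an isometry
intertwining it with `J`, then `J` is induced by a complex structure of the ambient space. -/
theorem exists_ambient_complexStructure_intertwining [ConnectedSpace M]
    (hJ : IsKaehlerStructure 𝓘(ℝ, E) J) (hf : IsIsometricImmersion 𝓘(ℝ, E) f)
    (hN : ∀ x : M, firstNormalSpace 𝓘(ℝ, E) f x = ⊤)
    (hα : ∀ (x : M) (v w : TangentSpace 𝓘(ℝ, E) x),
      𝒥 x (secondFundamentalForm 𝓘(ℝ, E) f x v w) =
        secondFundamentalForm 𝓘(ℝ, E) f x v (J x w)) :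
    ∃ P : W →L[ℝ] W, (∀ w, P (P w) = -w) ∧ (∀ u w, inner ℝ (P u) (P w) = inner ℝ u w) ∧
      ∀ (x : M) (v : TangentSpace 𝓘(ℝ, E) x),
        mvfderiv 𝓘(ℝ, E) f x (J x v) = P (mvfderiv 𝓘(ℝ, E) f x v) := by
  have hneg : ∀ (x : M) (v w : TangentSpace 𝓘(ℝ, E) x),
      secondFundamentalForm 𝓘(ℝ, E) f x v (-w) = -secondFundamentalForm 𝓘(ℝ, E) f x v w := by
    obtain ⟨cov, hcov, -⟩ := hJ.parallel
    exact fun x v w => secondFundamentalForm_neg_right hf hcov v w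
  have hex := fun x => exists_ambient_complexStructure (mvfderiv 𝓘(ℝ, E) f x).toLinearMap
    (by
      refine (injective_iff_map_eq_zero _).2 fun v hv => ?_
      have h : inner ℝ (mvfderiv 𝓘(ℝ, E) f x v) (mvfderiv 𝓘(ℝ, E) f x v) = (0 : ℝ) :=
        inner_self_eq_zero.2 hv
      rw [hf.isometric] at h
      exact inner_self_eq_zero.1 h)
    (J x).toLinearMap (hJ.sq x)
    (fun v w => ((hf.isometric x _ _).trans (hJ.orthogonal x v w)).trans
      (hf.isometric x v w).symm)
    (𝒥 x) (normal_isometry_sq hJ hN hα hneg x)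
  choose P hsq hiso hP₁ hP₂ using hex
  have hskew : ∀ x u w, inner ℝ (P x u) w = -inner ℝ u (P x w) := fun x u w => by
    rw [← hiso x u (P x w), hsq, inner_neg_right, neg_neg]
  have hlc := isLocallyConstant_ambient hJ hf hN hskew hP₁ fun Y x hY v =>
    ambient_apply_mvfderiv hJ hf hα hP₁ hP₂ hY v
  obtain ⟨x₀⟩ := (inferInstance : Nonempty M)
  refine ⟨P x₀, hsq x₀, hiso x₀, fun x v => ?_⟩
  rw [hlc.apply_eq_of_preconnectedSpace x₀ x]
  exact (hP₁ x v).symm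

end AmbientStructure

end RealKaehler

end

theorem mainTheorem5 (n p : ℕ)
    {M : Type*} [TopologicalSpace M] [T2Space M] [SecondCountableTopology M] [ConnectedSpace M]
    [ChartedSpace (EuclideanSpace ℝ (Fin (2 * n))) M]
    [IsManifold 𝓘(ℝ, EuclideanSpace ℝ (Fin (2 * n))) ∞ M]
    [RiemannianBundle
      (fun x : M => TangentSpace 𝓘(ℝ, EuclideanSpace ℝ (Fin (2 * n))) x)]
    [IsContMDiffRiemannianBundle 𝓘(ℝ, EuclideanSpace ℝ (Fin (2 * n))) ∞
      (EuclideanSpace ℝ (Fin (2 * n)))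
      (fun x : M => TangentSpace 𝓘(ℝ, EuclideanSpace ℝ (Fin (2 * n))) x)]
    (J : ∀ x : M, TangentSpace 𝓘(ℝ, EuclideanSpace ℝ (Fin (2 * n))) x →L[ℝ]
      TangentSpace 𝓘(ℝ, EuclideanSpace ℝ (Fin (2 * n))) x)
    (hJ : RealKaehler.IsKaehlerStructure 𝓘(ℝ, EuclideanSpace ℝ (Fin (2 * n))) J)
    (f : M → EuclideanSpace ℝ (Fin (2 * n + p)))
    (hf : RealKaehler.IsIsometricImmersion 𝓘(ℝ, EuclideanSpace ℝ (Fin (2 * n))) f)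
    (hN : ∀ x : M,
      RealKaehler.firstNormalSpace 𝓘(ℝ, EuclideanSpace ℝ (Fin (2 * n))) f x = ⊤)
    (𝒥 : ∀ x : M,
      RealKaehler.normalSpace 𝓘(ℝ, EuclideanSpace ℝ (Fin (2 * n))) f x ≃ₗᵢ[ℝ]
        RealKaehler.normalSpace 𝓘(ℝ, EuclideanSpace ℝ (Fin (2 * n))) f x)
    (h𝒥 : RealKaehler.IsSmoothNormalIsometry 𝓘(ℝ, EuclideanSpace ℝ (Fin (2 * n))) f 𝒥)
    (hα : ∀ (x : M) (v w : TangentSpace 𝓘(ℝ, EuclideanSpace ℝ (Fin (2 * n))) x),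
      𝒥 x (RealKaehler.secondFundamentalForm 𝓘(ℝ, EuclideanSpace ℝ (Fin (2 * n))) f x v w) =
        RealKaehler.secondFundamentalForm 𝓘(ℝ, EuclideanSpace ℝ (Fin (2 * n))) f x v (J x w)) :
    ∃ q : ℕ, p = 2 * q ∧
      ∃ φ : EuclideanSpace ℝ (Fin (2 * n + p)) ≃ₗᵢ[ℝ] EuclideanSpace ℂ (Fin (n + q)),
        RealKaehler.IsHolomorphicMap 𝓘(ℝ, EuclideanSpace ℝ (Fin (2 * n))) J
          (fun x => φ (f x)) := by
  obtain ⟨P, hsq, hiso, hP⟩ :=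
    RealKaehler.exists_ambient_complexStructure_intertwining hJ hf hN hα
  obtain ⟨m, hm, φ, hφ⟩ := RealKaehler.exists_linearIsometryEquiv_complex P hsq hiso
  rw [finrank_euclideanSpace_fin] at hm
  obtain ⟨q, rfl⟩ : ∃ q, m = n + q := ⟨m - n, by omega⟩
  refine ⟨q, by omega, φ, ?_, fun x v => ?_⟩
  · exact φ.toContinuousLinearEquiv.contDiff.contMDiff.comp hf.smooth
  · have h : ∀ w, mvfderiv 𝓘(ℝ, EuclideanSpace ℝ (Fin (2 * n))) (fun x => φ (f x)) x w =
        φ (mvfderiv 𝓘(ℝ, EuclideanSpace ℝ (Fin (2 * n))) f x w) := fun w => by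
      have h₁ := φ.toContinuousLinearEquiv.hasFDerivAt (x := f x) |>.hasMFDerivAt.comp x
        (hf.smooth.mdifferentiable (by simp) x).hasMFDerivAt
      exact congrArg (fun L => L w) h₁.mfderiv
    rw [h, h, hP, hφ]
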